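/- For each $n\ge 1$ let $X_1,\dots,X_n$ (where $X_i=X_{n,i}$, a triangular array) be independent real random variables whose laws are absolutely continuous with respect to Lebesgue measure; the laws may differ over $i$ and change with $n$. Let $$U_n^{\rm Ken}=U_n^{\rm Ken}(X_1,\dots,X_n)=\frac{1}{n(n-1)}\sum_{i\ne j}\mathbf 1(j<i)\,\mathbf 1(X_j>X_i)$$ be the (rescaled) Kendall's tau and $\sigma_n^2=\operatorname{Var}(U_n^{\rm Ken})$, $\sigma_n\ge 0$. Given $X_1,\dots,X_n$, let $X_1^*,\dots,X_n^*$ be i.i.d. draws from the empirical distribution of $X_1,\dots,X_n$, let $U_n^{{\rm Ken}*}=U_n^{\rm Ken}(X_1^*,\dots,X_n^*)$, and let $\operatorname{Var}^*$ be the conditional variance given $X_1,\dots,X_n$. Assume: 1. There are sequences $\delta_n,p_n\in(0,1)$ such that for all sufficiently large $n$ and each $i\in\{1,\dots,n\}$, at least one of the following holds: (i) $P\{P(X_j>X_i\mid X_i)-P(X_j>X_i)\in[\delta_n,1]\ \text{for all } j\ne i\}\ge p_n$; (ii) $P\{P(X_j>X_i\mid X_i)-P(X_j>X_i)\in[-1,-\delta_n]\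 \text{for all } j\ne i\}\ge p_n$. 2. $\delta_n^3p_n$ strictly dominates $n^{-1/3}$: $n^{-1/3}=O(\delta_n^3p_n)$, but $\delta_n^3p_n=O(n^{-1/3})$ fails. 3. There exist $\theta>0$ and $C>0$, not depending on $n$, such that for all $n$ and all $1\le i\ne j\le n$, $\ |P(X_i>X_j)-\theta|\le Cn^{-1/6}$. 4. There exist $\eta^2>0$ and $C'>0$, not depending on $n$, such that for all $n$ and all $1\le i,j,k\le n$ with $j\ne i$ and $k\ne i$ (the case $j=k$ included), $$\big|E\{P(X_j>X_i\mid X_i)\,P(X_k>X_i\mid X_i)\}-\eta^2\big|\le C'n^{-1/3}.$$ 5. $\eta^2\ne\theta^2$. Then $\sigma_n>0$ for all sufficiently large $n$, and Efron's bootstrap variance estimate is consistent: $$\big|\operatorname{Var}^*(\sigma_n^{-1}U_n^{{\rm Ken}*})-\operatorname{Var}(\sigma_n^{-1}U_n^{\rm Ken})\big|\xrightarrow{P}0 .$$ -/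

import Mathlib

open MeasureTheory ProbabilityTheory Filter Topology

noncomputable section

namespace BootstrapKendall

/-- The strict order relation between real sequences: `b n ≲ a n` (there is a constant `C`
with `|b n| ≤ C * |a n|` for all large `n`), whereas `a n ≲ b n` fails. -/
def StrictlyDominates (a b : ℕ → ℝ) : Prop :=
  b =O[atTop] a ∧ ¬ a =O[atTop] b

/-- The rescaled Kendall's tau `(τ + 1) / 4`,
`1 / (n (n - 1)) * ∑_{i ≠ j} 1(j < i) 1(x_j > x_i)`. -/
def kendallU {n : ℕ} (x : Fin n → ℝ) : ℝ :=
  1 / ((n : ℝ) * ((n : ℝ) - 1)) *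
    ∑ q ∈ (Finset.univ : Finset (Fin n)).offDiag,
      (if q.2 < q.1 then (1 : ℝ) else 0) * (if x q.2 > x q.1 then (1 : ℝ) else 0)

/-- The empirical distribution of `x_1, …, x_n`: mass `1 / n` at each of the points. -/
def empiricalLaw {n : ℕ} (x : Fin n → ℝ) : Measure ℝ :=
  (n : ENNReal)⁻¹ • ∑ i, Measure.dirac (x i)

/-- The law of an Efron bootstrap sample of size `n` given the data `x`:
`n` i.i.d. draws from the empirical distribution of `x`. -/
def bootstrapLaw {n : ℕ} (x : Fin n → ℝ) : Measure (Fin n → ℝ) :=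
  Measure.pi fun _ => empiricalLaw x

/-- The bootstrap variance `Var*(T(X*_1, …, X*_n))` of a statistic `T` given the data `x`. -/
def bootstrapVar {n : ℕ} (T : (Fin n → ℝ) → ℝ) (x : Fin n → ℝ) : ℝ :=
  variance T (bootstrapLaw x)

section RandomSample

variable {Ω : Type*} [MeasurableSpace Ω] {n : ℕ}

/-- `P(X_j > X_i)`. -/
def probGT (P : Measure Ω) (X : Fin n → Ω → ℝ) (j i : Fin n) : ℝ :=
  P.real {ω | X j ω > X i ω}

/-- The conditional probability `P(X_j > X_i | X_i)`, a random variable. -/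
def condProbGT (P : Measure Ω) (X : Fin n → Ω → ℝ) (j i : Fin n) : Ω → ℝ :=
  P[{ω | X j ω > X i ω}.indicator (fun _ => (1 : ℝ)) |
    MeasurableSpace.comap (X i) inferInstance]

/-- The standard deviation `σ_n` of the rescaled Kendall's tau of the sample. -/
def kendallSD (P : Measure Ω) (X : Fin n → Ω → ℝ) : ℝ :=
  √(variance (fun ω => kendallU fun i => X i ω) P)

end RandomSample

end BootstrapKendall

end

/-! The variance of the number of discordant pairs is a double sum of covariances of order
indicators, and each covariance involves at most four indices. Pairs without a common index are
independent. For pairs sharing one index the covariance depends only on the probabilities of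
orderings of two and three variables. If these are close to the values 1/2 and 1/3 of a continuous
i.i.d. sample, every such covariance is close to 1/12 or -1/12, with a sign that is pure
combinatorics. Summing the signs gives a variance of n(n^2 - 1)/36 up to o(n^3)
(`RankHomogeneous.abs_variance_sub_le`).

This applies to both worlds. In the data, absolute continuity excludes ties, so complementary order
probabilities add up to one; the homogeneity assumptions then force θ = 1/2 and η^2 = 1/3. In the
bootstrap world, a sample from n distinct points is i.i.d. with atoms of mass at most 1/n, whatever
the points are (`rankHomogeneous_bootstrapLaw`). Both variances thus have the same leading term of
order n^3, and their relative difference has a deterministic vanishing bound off the null event of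
ties. -/

noncomputable section

namespace BootstrapKendall

/-! ### Combinatorics of ordered index pairs -/

/-- The pairs `(i, j)` of indices with `j < i`. -/
def descPairs (n : ℕ) : Finset (Fin n × Fin n) :=
  Finset.univ.filter fun q => q.2 < q.1

/-- `1` if `a = b`, and `0` otherwise. -/
def kron {n : ℕ} (a b : Fin n) : ℝ := if a = b then 1 else 0

/-- The sign with which a common index of two pairs contributes to a covariance. -/
def pairSign {n : ℕ} (q r : Fin n × Fin n) : ℝ :=
  kron q.1 r.1 - kron q.1 r.2 - kron q.2 r.1 + kron q.2 r.2

/-- The number of coincidences between the entries of two pairs. -/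
def pairShare {n : ℕ} (q r : Fin n × Fin n) : ℝ :=
  kron q.1 r.1 + kron q.1 r.2 + kron q.2 r.1 + kron q.2 r.2

lemma kron_nonneg {n : ℕ} (a b : Fin n) : 0 ≤ kron a b := by
  unfold kron; split_ifs <;> norm_num

lemma sum_kron_mul_kron {n : ℕ} (a b : Fin n) : ∑ c, kron a c * kron b c = kron a b := by
  simp [kron]

/-- An inner product of vectors e_i - e_j: the double sum over pairs becomes the squared norm of a
single sum. -/
lemma pairSign_eq_sum {n : ℕ} (q r : Fin n × Fin n) :
    pairSign q r = ∑ a, (kron q.1 a - kron q.2 a) * (kron r.1 a - kron r.2 a) := by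
  simp only [sub_mul, mul_sub, Finset.sum_sub_distrib, sum_kron_mul_kron, pairSign]
  ring

lemma sum_descPairs {n : ℕ} (f : Fin n → Fin n → ℝ) :
    ∑ q ∈ descPairs n, f q.1 q.2 = ∑ i, ∑ j, if j < i then f i j else 0 := by
  rw [descPairs, Finset.sum_filter, ← Finset.univ_product_univ, Finset.sum_product]

/-- The index a is the larger entry of a pairs and the smaller entry of n - 1 - a pairs. -/
lemma sum_kron_sub_kron {n : ℕ} (a : Fin n) :
    ∑ q ∈ descPairs n, (kron q.1 a - kron q.2 a) = 2 * (a : ℝ) - ((n : ℝ) - 1) := by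
  rw [Finset.sum_sub_distrib]
  have h1 : ∑ q ∈ descPairs n, kron q.1 a = a := by
    rw [sum_descPairs (fun i _ => kron i a), Finset.sum_eq_single a]
    · simp only [kron, if_true, Finset.sum_boole]
      rw [Finset.filter_gt_eq_Iio, Fin.card_Iio]
    · intro b _ hb; simp [kron, hb]
    · simp
  have h2 : ∑ q ∈ descPairs n, kron q.2 a = (n : ℝ) - 1 - a := by
    rw [sum_descPairs (fun _ j => kron j a), Finset.sum_comm, Finset.sum_eq_single a]
    · simp only [kron, if_true, Finset.sum_boole]
      rw [Finset.filter_lt_eq_Ioi, Fin.card_Ioi]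
      have := a.2
      rw [Nat.cast_sub (by omega), Nat.cast_sub (by omega)]; simp
    · intro b _ hb; simp [kron, hb]
    · simp
  rw [h1, h2]; ring

lemma sum_sq_two_mul_sub (n : ℕ) :
    ∑ a : Fin n, (2 * (a : ℝ) - ((n : ℝ) - 1)) ^ 2 = n * ((n : ℝ) ^ 2 - 1) / 3 := by
  rw [Fin.sum_univ_eq_sum_range (fun a => (2 * (a : ℝ) - ((n : ℝ) - 1)) ^ 2)]
  have key : ∀ (c : ℝ) (m : ℕ), ∑ a ∈ Finset.range m, (2 * (a : ℝ) - c) ^ 2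
      = 4 * ((m : ℝ) * (m - 1) * (2 * m - 1) / 6) - 2 * c * (m * (m - 1)) + m * c ^ 2 := by
    intro c m
    induction m with
    | zero => simp
    | succ k ih => rw [Finset.sum_range_succ, ih]; push_cast; ring
  rw [key]; ring

lemma sum_pairSign (n : ℕ) :
    ∑ q ∈ descPairs n, ∑ r ∈ descPairs n, pairSign q r = n * ((n : ℝ) ^ 2 - 1) / 3 := by
  simp_rw [pairSign_eq_sum]
  simp_rw [Finset.sum_comm (s := descPairs n) (t := Finset.univ), ← Finset.mul_sum,
    ← Finset.sum_mul, sum_kron_sub_kron, ← sq]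
  exact sum_sq_two_mul_sub n

lemma sum_kron_fst {n : ℕ} (a : Fin n) : ∑ r : Fin n × Fin n, kron a r.1 = n := by
  rw [Fintype.sum_prod_type_right]; simp [kron]

lemma sum_kron_snd {n : ℕ} (a : Fin n) : ∑ r : Fin n × Fin n, kron a r.2 = n := by
  rw [Fintype.sum_prod_type]; simp [kron]

lemma sum_pairShare_le (n : ℕ) :
    ∑ q ∈ descPairs n, ∑ r ∈ descPairs n, pairShare q r ≤ 4 * (n : ℝ) ^ 3 := by
  have hnn : ∀ q r : Fin n × Fin n, 0 ≤ pairShare q r := fun q r => by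
    have := kron_nonneg q.1 r.1
    have := kron_nonneg q.1 r.2
    have := kron_nonneg q.2 r.1
    have := kron_nonneg q.2 r.2
    unfold pairShare; linarith
  calc ∑ q ∈ descPairs n, ∑ r ∈ descPairs n, pairShare q r
      ≤ ∑ q : Fin n × Fin n, ∑ r : Fin n × Fin n, pairShare q r := by
        refine (Finset.sum_le_sum fun q _ => Finset.sum_le_sum_of_subset_of_nonneg
          (Finset.subset_univ _) fun r _ _ => hnn q r).trans ?_
        exact Finset.sum_le_sum_of_subset_of_nonneg (Finset.subset_univ _)
          fun q _ _ => Finset.sum_nonneg fun r _ => hnn q r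
    _ = 4 * (n : ℝ) ^ 3 := by
        simp only [pairShare, Finset.sum_add_distrib, sum_kron_fst, sum_kron_snd, Finset.sum_const,
          Finset.card_univ, Fintype.card_prod, Fintype.card_fin, nsmul_eq_mul, Nat.cast_mul]
        ring

lemma card_descPairs_le (n : ℕ) : ((descPairs n).card : ℝ) ≤ (n : ℝ) ^ 2 := by
  have : (descPairs n).card ≤ n * n := by
    simpa using Finset.card_le_univ (descPairs n)
  rw [sq]; exact_mod_cast this

lemma kendallU_eq {n : ℕ} (x : Fin n → ℝ) :
    kendallU x = 1 / ((n : ℝ) * ((n : ℝ) - 1)) *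
      ∑ q ∈ descPairs n, if x q.2 > x q.1 then (1 : ℝ) else 0 := by
  unfold kendallU descPairs
  congr 1
  rw [Finset.sum_filter]
  simp_rw [ite_mul, one_mul, zero_mul]
  refine Finset.sum_subset (Finset.subset_univ _) fun q _ hq => if_neg fun h => hq ?_
  simpa using h.ne'

end BootstrapKendall
end

/-! ### Covariances of order indicators and the variance expansion -/

noncomputable section

namespace BootstrapKendall

section Covariances

variable {Ω : Type*} [MeasurableSpace Ω] {n : ℕ}

/-- The event `Y_j > Y_i`. -/
def gtSet (Y : Fin n → Ω → ℝ) (j i : Fin n) : Set Ω := {ω | Y j ω > Y i ω}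

/-- Independent random variables whose order relations have, up to `ε`, the same probabilities
as those of a sample from a continuous distribution. -/
structure RankHomogeneous (P : Measure Ω) (Y : Fin n → Ω → ℝ) (ε : ℝ) : Prop where
  measurable : ∀ i, Measurable (Y i)
  indep : iIndepFun Y P
  tie : ∀ i j, i ≠ j → P.real {ω | Y i ω = Y j ω} ≤ ε
  pair : ∀ i j, i ≠ j → |P.real (gtSet Y j i) - 1 / 2| ≤ ε
  triple : ∀ i j k, i ≠ j → i ≠ k → j ≠ k →
    |P.real (gtSet Y j i ∩ gtSet Y k i) - 1 / 3| ≤ ε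

lemma measurableSet_gtSet {Y : Fin n → Ω → ℝ} (hY : ∀ i, Measurable (Y i)) (j i : Fin n) :
    MeasurableSet (gtSet Y j i) := measurableSet_lt (hY i) (hY j)

lemma memLp_indicator_one {P : Measure Ω} [IsProbabilityMeasure P] {A : Set Ω}
    (hA : MeasurableSet A) : MemLp (A.indicator (1 : Ω → ℝ)) 2 P :=
  memLp_indicator_const 2 hA (1 : ℝ) (Or.inr (measure_ne_top P A))

lemma covariance_indicator_one {P : Measure Ω} [IsProbabilityMeasure P] {A B : Set Ω}
    (hA : MeasurableSet A) (hB : MeasurableSet B) :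
    cov[A.indicator (1 : Ω → ℝ), B.indicator (1 : Ω → ℝ); P]
      = P.real (A ∩ B) - P.real A * P.real B := by
  rw [covariance_eq_sub (memLp_indicator_one hA) (memLp_indicator_one hB),
    ← Set.inter_indicator_one, integral_indicator_one (hA.inter hB), integral_indicator_one hA,
    integral_indicator_one hB]

lemma abs_mul_sub_quarter_le {a b ε : ℝ} (ha : |a - 1 / 2| ≤ ε) (hb : |b - 1 / 2| ≤ ε)
    (ha0 : 0 ≤ a) (ha1 : a ≤ 1) : |a * b - 1 / 4| ≤ 2 * ε := by
  rw [abs_le] at *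
  constructor <;> nlinarith

namespace RankHomogeneous

variable {P : Measure Ω} [IsProbabilityMeasure P] {Y : Fin n → Ω → ℝ} {ε : ℝ}

/-- Inclusion-exclusion on the complement: 1 - 1/2 - 1/2 + 1/3. The error is 2ε from the pairs, ε
from the triple and 2ε from ties. -/
lemma triple_max (h : RankHomogeneous P Y ε) {i j k : Fin n} (hij : i ≠ j) (hik : i ≠ k)
    (hjk : j ≠ k) : |P.real (gtSet Y i j ∩ gtSet Y i k) - 1 / 3| ≤ 5 * ε := by
  have hm := measurableSet_gtSet h.measurable
  have h1 := abs_le.1 (h.pair i j hij)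
  have h2 := abs_le.1 (h.pair i k hik)
  have h3 := abs_le.1 (h.triple i j k hij hik hjk)
  have t1 := h.tie i j hij
  have t2 := h.tie i k hik
  have hu := measureReal_union_add_inter (μ := P) (s := gtSet Y j i) (hm k i)
  have hc := measureReal_compl (μ := P) ((hm j i).union (hm k i))
  rw [probReal_univ] at hc
  have hle : P.real (gtSet Y i j ∩ gtSet Y i k) ≤ P.real (gtSet Y j i ∪ gtSet Y k i)ᶜ := by
    refine measureReal_mono fun ω hω => ?_
    simp only [gtSet, Set.mem_inter_iff, Set.mem_ofPred_eq, Set.mem_compl_iff, Set.mem_union,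
      not_or, not_lt] at hω ⊢
    exact ⟨hω.1.le, hω.2.le⟩
  have hge : P.real (gtSet Y j i ∪ gtSet Y k i)ᶜ ≤ P.real (gtSet Y i j ∩ gtSet Y i k)
      + P.real {ω | Y i ω = Y j ω} + P.real {ω | Y i ω = Y k ω} := by
    refine le_trans (measureReal_mono ?_) ((measureReal_union_le _ _).trans
      (add_le_add_left (measureReal_union_le _ _) _))
    intro ω hω
    simp only [gtSet, Set.mem_inter_iff, Set.mem_ofPred_eq, Set.mem_compl_iff, Set.mem_union,
      not_or, not_lt] at hω ⊢
    rcases hω.1.lt_or_eq with ha | ha <;> rcases hω.2.lt_or_eq with hb | hb <;> simp [ha, hb]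
  rw [abs_le]
  constructor <;> linarith

/-- Removing the triple event from the pair event leaves 1/2 - 1/3, up to a tie. -/
lemma triple_mid (h : RankHomogeneous P Y ε) {i j k : Fin n} (hij : i ≠ j) (hik : i ≠ k)
    (hjk : j ≠ k) : |P.real (gtSet Y j i ∩ gtSet Y i k) - 1 / 6| ≤ 3 * ε := by
  have hm := measurableSet_gtSet h.measurable
  have h1 := abs_le.1 (h.pair i j hij)
  have h3 := abs_le.1 (h.triple i j k hij hik hjk)
  have t2 := h.tie i k hik
  have hd := measureReal_inter_add_sdiff (μ := P) (s := gtSet Y j i) (hm k i)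
  have hle : P.real (gtSet Y j i ∩ gtSet Y i k) ≤ P.real (gtSet Y j i \ gtSet Y k i) := by
    refine measureReal_mono fun ω hω => ?_
    simp only [gtSet, Set.mem_inter_iff, Set.mem_ofPred_eq, Set.mem_sdiff, not_lt] at hω ⊢
    exact ⟨hω.1, hω.2.le⟩
  have hge : P.real (gtSet Y j i \ gtSet Y k i) ≤ P.real (gtSet Y j i ∩ gtSet Y i k)
      + P.real {ω | Y i ω = Y k ω} := by
    refine le_trans (measureReal_mono ?_) (measureReal_union_le _ _)
    intro ω hω
    simp only [gtSet, Set.mem_inter_iff, Set.mem_ofPred_eq, Set.mem_sdiff, Set.mem_union,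
      not_lt] at hω ⊢
    rcases hω.2.lt_or_eq with ha | ha
    · exact Or.inl ⟨hω.1, ha⟩
    · exact Or.inr ha.symm
  rw [abs_le]
  constructor <;> linarith

/-- A shared index in the same position gives 1/3 - 1/4 = 1/12, in opposite positions 1/6 - 1/4 =
-1/12. The 7 is the worst triple error 5 plus 2 for the product of the pair probabilities. -/
lemma abs_covariance_sub_le (h : RankHomogeneous P Y ε) {q r : Fin n × Fin n}
    (hq : q.2 < q.1) (hr : r.2 < r.1) :
    |cov[(gtSet Y q.2 q.1).indicator (1 : Ω → ℝ), (gtSet Y r.2 r.1).indicator (1 : Ω → ℝ); P]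
      - pairSign q r / 12| ≤ 7 * ε * pairShare q r + if q = r then 1 else 0 := by
  have hm := measurableSet_gtSet h.measurable
  obtain ⟨i, j⟩ := q
  obtain ⟨i', j'⟩ := r
  simp only at hq hr ⊢
  have hε : 0 ≤ ε := (abs_nonneg _).trans (h.pair i j hq.ne')
  have hprod := abs_le.1 (abs_mul_sub_quarter_le (h.pair i j hq.ne') (h.pair i' j' hr.ne')
    measureReal_nonneg measureReal_le_one)
  rw [covariance_indicator_one (hm _ _) (hm _ _)]
  by_cases h11 : i = i'
  · subst h11
    by_cases h22 : j = j'
    · subst h22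
      -- There are at most n^2 diagonal terms, so a crude bound by 1 is enough here.
      have ha0 : 0 ≤ P.real (gtSet Y j i) := measureReal_nonneg
      have ha1 : P.real (gtSet Y j i) ≤ 1 := measureReal_le_one
      simp only [pairSign, pairShare, kron, hq.ne, hq.ne', Set.inter_self, if_true, if_false,
        abs_le]
      constructor <;> nlinarith
    · have := abs_le.1 (h.triple i j j' hq.ne' hr.ne' h22)
      simp only [pairSign, pairShare, kron, hq.ne, hr.ne', h22, if_true, if_false, abs_le,
        Prod.mk.injEq, and_false]
      constructor <;> linarith
  · by_cases h22 : j = j'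
    · subst h22
      have := abs_le.1 (h.triple_max hq.ne hr.ne h11)
      simp only [pairSign, pairShare, kron, hq.ne', hr.ne, h11, if_true, if_false, abs_le,
        Prod.mk.injEq, false_and]
      constructor <;> linarith
    · by_cases h12 : i = j'
      · subst h12
        -- Both pairs are descending, so they cannot be swaps of each other.
        have h21 : j ≠ i' := (hq.trans hr).ne
        have := abs_le.1 (h.triple_mid hq.ne' hr.ne h21)
        simp only [pairSign, pairShare, kron, hq.ne, h11, h21, if_true, if_false, abs_le,
          Prod.mk.injEq, false_and]
        constructor <;> linarith
      · by_cases h21 : j = i'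
        · subst h21
          have := abs_le.1 (h.triple_mid hr.ne' hq.ne (Ne.symm h12))
          rw [Set.inter_comm] at this
          simp only [pairSign, pairShare, kron, h12, h11, h22, if_true, if_false, abs_le,
            Prod.mk.injEq, false_and]
          constructor <;> linarith
        · have hind := h.indep.indepFun_prodMk_prodMk h.measurable i j i' j' h11 h12 h21 h22
          have hS : MeasurableSet {z : ℝ × ℝ | z.2 > z.1} :=
            measurableSet_lt measurable_fst measurable_snd
          have := hind.measure_inter_preimage_eq_mul _ _ hS hS
          have h0 : P.real (gtSet Y j i ∩ gtSet Y j' i')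
              = P.real (gtSet Y j i) * P.real (gtSet Y j' i') := by
            simp only [measureReal_def, ← ENNReal.toReal_mul]
            exact congrArg ENNReal.toReal this
          simp [pairSign, pairShare, kron, h11, h12, h21, h22, h0]

/-- The variance of Kendall's tau is determined up to lower order terms by the probabilities of
the order relations in pairs and triples. -/
theorem abs_variance_sub_le (h : RankHomogeneous P Y ε) (hε : 0 ≤ ε) :
    |Var[fun ω => ∑ q ∈ descPairs n, if Y q.2 ω > Y q.1 ω then (1 : ℝ) else 0; P]
      - n * ((n : ℝ) ^ 2 - 1) / 36| ≤ 28 * ε * (n : ℝ) ^ 3 + (n : ℝ) ^ 2 := by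
  have hm := measurableSet_gtSet h.measurable
  have hfun : (fun ω => ∑ q ∈ descPairs n, if Y q.2 ω > Y q.1 ω then (1 : ℝ) else 0)
      = fun ω => ∑ q ∈ descPairs n, (gtSet Y q.2 q.1).indicator (1 : Ω → ℝ) ω := by
    funext ω
    refine Finset.sum_congr rfl fun q _ => ?_
    simp [Set.indicator_apply, gtSet]
  have hs : (n : ℝ) * ((n : ℝ) ^ 2 - 1) / 36
      = ∑ q ∈ descPairs n, ∑ r ∈ descPairs n, pairSign q r / 12 := by
    simp_rw [← Finset.sum_div]
    rw [sum_pairSign]; ring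
  rw [hfun, variance_fun_sum' fun q _ => memLp_indicator_one (hm _ _), hs,
    ← Finset.sum_sub_distrib]
  simp_rw [← Finset.sum_sub_distrib]
  calc _ ≤ ∑ q ∈ descPairs n, ∑ r ∈ descPairs n,
        (7 * ε * pairShare q r + if q = r then 1 else 0) := by
        refine (Finset.abs_sum_le_sum_abs _ _).trans (Finset.sum_le_sum fun q hq => ?_)
        refine (Finset.abs_sum_le_sum_abs _ _).trans (Finset.sum_le_sum fun r hr => ?_)
        exact h.abs_covariance_sub_le (Finset.mem_filter.1 hq).2 (Finset.mem_filter.1 hr).2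
    _ = 7 * ε * (∑ q ∈ descPairs n, ∑ r ∈ descPairs n, pairShare q r)
          + (descPairs n).card := by
        simp [Finset.sum_add_distrib, Finset.mul_sum]
    _ ≤ _ := by
        have h1 := mul_le_mul_of_nonneg_left (sum_pairShare_le n) (by positivity : 0 ≤ 7 * ε)
        have h2 := card_descPairs_le n
        linarith

end RankHomogeneous

end Covariances

end BootstrapKendall
end

/-! ### Order probabilities as integrals and under conditioning -/

noncomputable section

namespace BootstrapKendall

section OrderProbabilities

variable {Ω : Type*} [MeasurableSpace Ω] {n : ℕ} {P : Measure Ω} [IsProbabilityMeasure P]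
  {Y : Fin n → Ω → ℝ}

lemma map_prodMk_eq_prod (hY : ∀ i, Measurable (Y i)) (hind : iIndepFun Y P) {i j : Fin n}
    (hij : i ≠ j) :
    P.map (fun ω => (Y i ω, Y j ω)) = (P.map (Y i)).prod (P.map (Y j)) :=
  (indepFun_iff_map_prod_eq_prod_map_map (hY i).aemeasurable (hY j).aemeasurable).1
    (hind.indepFun hij)

lemma map_prodMk_prodMk_eq_prod (hY : ∀ i, Measurable (Y i)) (hind : iIndepFun Y P)
    {i j k : Fin n} (hij : i ≠ j) (hik : i ≠ k) (hjk : j ≠ k) :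
    P.map (fun ω => (Y i ω, (Y j ω, Y k ω)))
      = (P.map (Y i)).prod ((P.map (Y j)).prod (P.map (Y k))) := by
  rw [← map_prodMk_eq_prod hY hind hjk]
  exact (indepFun_iff_map_prod_eq_prod_map_map (hY i).aemeasurable
    ((hY j).prodMk (hY k)).aemeasurable).1
    (hind.indepFun_prodMk hY j k i hij.symm hik.symm).symm

lemma prod_real_eq_integral {α β : Type*} [MeasurableSpace α] [MeasurableSpace β]
    (μ : Measure α) (ν : Measure β) [IsProbabilityMeasure μ] [IsProbabilityMeasure ν]
    {s : Set (α × β)} (hs : MeasurableSet s) :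
    (μ.prod ν).real s = ∫ x, ν.real (Prod.mk x ⁻¹' s) ∂μ := by
  simp only [measureReal_def]
  rw [Measure.prod_apply hs, integral_toReal (measurable_measure_prodMk_left hs).aemeasurable
    (Eventually.of_forall fun x => measure_lt_top _ _)]

lemma probReal_gtSet (hY : ∀ i, Measurable (Y i)) (hind : iIndepFun Y P) {i j : Fin n}
    (hij : i ≠ j) :
    P.real (gtSet Y j i) = ∫ x, (P.map (Y j)).real (Set.Ioi x) ∂(P.map (Y i)) := by
  have := fun i => Measure.isProbabilityMeasure_map (μ := P) (hY i).aemeasurable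
  have hS : MeasurableSet {z : ℝ × ℝ | z.1 < z.2} := measurableSet_lt measurable_fst measurable_snd
  have h1 : P.real (gtSet Y j i) = (P.map (fun ω => (Y i ω, Y j ω))).real {z | z.1 < z.2} := by
    rw [map_measureReal_apply ((hY i).prodMk (hY j)) hS]; rfl
  rw [h1, map_prodMk_eq_prod hY hind hij, prod_real_eq_integral _ _ hS]
  rfl

lemma probReal_gtSet_inter_gtSet (hY : ∀ i, Measurable (Y i)) (hind : iIndepFun Y P)
    {i j k : Fin n} (hij : i ≠ j) (hik : i ≠ k) (hjk : j ≠ k) :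
    P.real (gtSet Y j i ∩ gtSet Y k i)
      = ∫ x, (P.map (Y j)).real (Set.Ioi x) * (P.map (Y k)).real (Set.Ioi x) ∂(P.map (Y i)) := by
  have := fun i => Measure.isProbabilityMeasure_map (μ := P) (hY i).aemeasurable
  have hS : MeasurableSet {z : ℝ × ℝ × ℝ | z.1 < z.2.1 ∧ z.1 < z.2.2} :=
    (measurableSet_lt measurable_fst (measurable_fst.comp measurable_snd)).inter
      (measurableSet_lt measurable_fst (measurable_snd.comp measurable_snd))
  have h1 : P.real (gtSet Y j i ∩ gtSet Y k i)
      = (P.map (fun ω => (Y i ω, (Y j ω, Y k ω)))).real {z | z.1 < z.2.1 ∧ z.1 < z.2.2} := by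
    rw [map_measureReal_apply ((hY i).prodMk ((hY j).prodMk (hY k))) hS]; rfl
  rw [h1, map_prodMk_prodMk_eq_prod hY hind hij hik hjk, prod_real_eq_integral _ _ hS]
  refine integral_congr_ae (Eventually.of_forall fun x => ?_)
  exact measureReal_prod_prod (Set.Ioi x) (Set.Ioi x)

lemma probReal_eq_le (hY : ∀ i, Measurable (Y i)) (hind : iIndepFun Y P) {i j : Fin n}
    (hij : i ≠ j) {τ : ℝ} (hτ : ∀ x, (P.map (Y j)).real {x} ≤ τ) :
    P.real {ω | Y i ω = Y j ω} ≤ τ := by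
  have := fun i => Measure.isProbabilityMeasure_map (μ := P) (hY i).aemeasurable
  have hS : MeasurableSet {z : ℝ × ℝ | z.1 = z.2} :=
    measurableSet_eq_fun measurable_fst measurable_snd
  have h1 : P.real {ω | Y i ω = Y j ω}
      = (P.map (fun ω => (Y i ω, Y j ω))).real {z | z.1 = z.2} := by
    rw [map_measureReal_apply ((hY i).prodMk (hY j)) hS]; rfl
  have hpre : ∀ x : ℝ, Prod.mk x ⁻¹' {z : ℝ × ℝ | z.1 = z.2} = {x} := fun x => by
    ext y; simp [eq_comm]
  rw [h1, map_prodMk_eq_prod hY hind hij, prod_real_eq_integral _ _ hS]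
  simp_rw [hpre]
  have h0 : 0 ≤ τ := measureReal_nonneg.trans (hτ 0)
  calc _ ≤ ∫ _, τ ∂(P.map (Y i)) :=
        integral_mono_of_nonneg (Eventually.of_forall fun x => measureReal_nonneg)
          (integrable_const _) (Eventually.of_forall hτ)
    _ = τ := by simp

lemma probReal_gtSet_add_mem_Icc (hY : ∀ i, Measurable (Y i)) {i j : Fin n} {τ : ℝ}
    (hτ : P.real {ω | Y i ω = Y j ω} ≤ τ) :
    P.real (gtSet Y i j) + P.real (gtSet Y j i) ∈ Set.Icc (1 - τ) 1 := by
  have hm := measurableSet_gtSet hY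
  have hd : Disjoint (gtSet Y i j) (gtSet Y j i) :=
    Set.disjoint_left.2 fun ω h1 h2 => lt_asymm (a := Y i ω) (b := Y j ω) h2 h1
  have hu := measureReal_union (μ := P) hd (hm j i)
  refine ⟨?_, hu ▸ measureReal_le_one⟩
  have hcov : (Set.univ : Set Ω) ⊆ (gtSet Y i j ∪ gtSet Y j i) ∪ {ω | Y i ω = Y j ω} := by
    intro ω _
    rcases lt_trichotomy (Y i ω) (Y j ω) with h | h | h <;> simp [gtSet, h]
  have h1 := (measureReal_mono (μ := P) hcov).trans (measureReal_union_le _ _)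
  rw [probReal_univ] at h1
  linarith

/-- Off the three tie events exactly one of the variables is the strict minimum. -/
lemma probReal_triple_add_mem_Icc (hY : ∀ i, Measurable (Y i)) {i j k : Fin n} {τ : ℝ}
    (hij : P.real {ω | Y i ω = Y j ω} ≤ τ) (hik : P.real {ω | Y i ω = Y k ω} ≤ τ)
    (hjk : P.real {ω | Y j ω = Y k ω} ≤ τ) :
    P.real (gtSet Y j i ∩ gtSet Y k i) + P.real (gtSet Y i j ∩ gtSet Y k j)
      + P.real (gtSet Y i k ∩ gtSet Y j k) ∈ Set.Icc (1 - 3 * τ) 1 := by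
  have hm := measurableSet_gtSet hY
  have hd1 : Disjoint (gtSet Y j i ∩ gtSet Y k i) (gtSet Y i j ∩ gtSet Y k j) :=
    Set.disjoint_left.2 fun ω h1 h2 => lt_asymm (a := Y i ω) (b := Y j ω) h1.1 h2.1
  have hd2 : Disjoint ((gtSet Y j i ∩ gtSet Y k i) ∪ (gtSet Y i j ∩ gtSet Y k j))
      (gtSet Y i k ∩ gtSet Y j k) :=
    Set.disjoint_left.2 fun ω h1 h2 => by
      rcases h1 with h1 | h1
      · exact lt_asymm (a := Y i ω) (b := Y k ω) h1.2 h2.1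
      · exact lt_asymm (a := Y j ω) (b := Y k ω) h1.2 h2.2
  have hu1 := measureReal_union (μ := P) hd1 ((hm i j).inter (hm k j))
  have hu2 := measureReal_union (μ := P) hd2 ((hm i k).inter (hm j k))
  rw [← hu1, ← hu2]
  refine ⟨?_, measureReal_le_one⟩
  have hcov : (Set.univ : Set Ω) ⊆ (((gtSet Y j i ∩ gtSet Y k i) ∪ (gtSet Y i j ∩ gtSet Y k j))
      ∪ (gtSet Y i k ∩ gtSet Y j k)) ∪ (({ω | Y i ω = Y j ω} ∪ {ω | Y i ω = Y k ω})
        ∪ {ω | Y j ω = Y k ω}) := by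
    intro ω _
    simp only [gtSet, Set.mem_union, Set.mem_inter_iff, Set.mem_ofPred_eq]
    grind
  have h1 := (measureReal_mono (μ := P) hcov).trans (measureReal_union_le _ _)
  have h2 := measureReal_union_le (μ := P) ({ω | Y i ω = Y j ω} ∪ {ω | Y i ω = Y k ω})
    {ω | Y j ω = Y k ω}
  have h3 := measureReal_union_le (μ := P) {ω | Y i ω = Y j ω} {ω | Y i ω = Y k ω}
  rw [probReal_univ] at h1
  linarith

/-- A sample of i.i.d. random variables with atoms of mass at most `τ`. -/
lemma rankHomogeneous_of_map_eq (hY : ∀ i, Measurable (Y i)) (hind : iIndepFun Y P)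
    {μ : Measure ℝ} (hμ : ∀ i, P.map (Y i) = μ) {τ : ℝ} (hτ : ∀ x, μ.real {x} ≤ τ) :
    RankHomogeneous P Y τ := by
  have htie : ∀ i j, i ≠ j → P.real {ω | Y i ω = Y j ω} ≤ τ := fun i j hij =>
    probReal_eq_le hY hind hij fun x => by rw [hμ]; exact hτ x
  have h0 : 0 ≤ τ := measureReal_nonneg.trans (hτ 0)
  refine ⟨hY, hind, htie, fun i j hij => ?_, fun i j k hij hik hjk => ?_⟩
  · have h := probReal_gtSet_add_mem_Icc hY (htie i j hij)
    rw [probReal_gtSet hY hind hij, probReal_gtSet hY hind hij.symm] at h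
    rw [probReal_gtSet hY hind hij]
    simp only [hμ, Set.mem_Icc] at h ⊢
    rw [abs_le]
    constructor <;> linarith
  · have h := probReal_triple_add_mem_Icc hY (htie i j hij) (htie i k hik) (htie j k hjk)
    rw [probReal_gtSet_inter_gtSet hY hind hij hik hjk,
      probReal_gtSet_inter_gtSet hY hind hij.symm hjk hik,
      probReal_gtSet_inter_gtSet hY hind hik.symm hjk.symm hij] at h
    rw [probReal_gtSet_inter_gtSet hY hind hij hik hjk]
    -- Under a common law the three integrals coincide, so three times their value lies in [1 - 3τ,
    -- 1].
    simp only [hμ, Set.mem_Icc] at h ⊢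
    rw [abs_le]
    constructor <;> linarith

/-- Independence makes the conditional distribution of `Y j` given `Y i` a constant kernel. -/
lemma condProbGT_ae_eq (hY : ∀ i, Measurable (Y i)) (hind : iIndepFun Y P) {i j : Fin n}
    (hij : i ≠ j) :
    condProbGT P Y j i =ᵐ[P] fun ω => (P.map (Y j)).real (Set.Ioi (Y i ω)) := by
  have := fun i => Measure.isProbabilityMeasure_map (μ := P) (hY i).aemeasurable
  have hS : MeasurableSet {z : ℝ × ℝ | z.1 < z.2} := measurableSet_lt measurable_fst measurable_snd
  have hcd : condDistrib (Y j) (Y i) P =ᵐ[P.map (Y i)] Kernel.const ℝ (P.map (Y j)) := by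
    refine condDistrib_ae_eq_of_measure_eq_compProd (Y i) (hY j).aemeasurable ?_
    rw [Measure.compProd_const, map_prodMk_eq_prod hY hind hij]
  have h1 : condProbGT P Y j i =ᵐ[P] fun ω =>
      ∫ y, ({z : ℝ × ℝ | z.1 < z.2}.indicator (fun _ => (1 : ℝ))) (Y i ω, y)
        ∂condDistrib (Y j) (Y i) P (Y i ω) := by
    refine condExp_prod_ae_eq_integral_condDistrib
      (f := {z : ℝ × ℝ | z.1 < z.2}.indicator (fun _ => (1 : ℝ))) (hY i) (hY j).aemeasurable
      (stronglyMeasurable_const.indicator hS) ?_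
    exact (integrable_const (1 : ℝ)).indicator (measurableSet_gtSet hY j i)
  filter_upwards [h1, ae_of_ae_map (hY i).aemeasurable hcd] with ω h1 h2
  rw [h1, h2, Kernel.const_apply]
  have : (fun y => ({z : ℝ × ℝ | z.1 < z.2}.indicator (fun _ => (1 : ℝ))) (Y i ω, y))
      = (Set.Ioi (Y i ω)).indicator 1 := by
    funext y; simp [Set.indicator_apply]
  rw [this, integral_indicator_one measurableSet_Ioi]

lemma integral_condProbGT_mul (hY : ∀ i, Measurable (Y i)) (hind : iIndepFun Y P)
    {i j k : Fin n} (hij : i ≠ j) (hik : i ≠ k) (hjk : j ≠ k) :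
    ∫ ω, condProbGT P Y j i ω * condProbGT P Y k i ω ∂P
      = P.real (gtSet Y j i ∩ gtSet Y k i) := by
  have hanti : ∀ l, Measurable fun x => (P.map (Y l)).real (Set.Ioi x) := fun l =>
    Antitone.measurable fun x y hxy => by
      have := Measure.isProbabilityMeasure_map (μ := P) (hY l).aemeasurable
      exact measureReal_mono (Set.Ioi_subset_Ioi hxy)
  rw [probReal_gtSet_inter_gtSet hY hind hij hik hjk, integral_map (hY i).aemeasurable
    (f := fun x => (P.map (Y j)).real (Set.Ioi x) * (P.map (Y k)).real (Set.Ioi x))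
    ((hanti j).mul (hanti k)).aestronglyMeasurable]
  refine integral_congr_ae ?_
  filter_upwards [condProbGT_ae_eq hY hind hij, condProbGT_ae_eq hY hind hik] with ω h1 h2
  rw [h1, h2]

end OrderProbabilities

/-! ### The bootstrap sample as an i.i.d. sample with small atoms -/

section Bootstrap

variable {n : ℕ}

lemma isProbabilityMeasure_empiricalLaw (hn : n ≠ 0) (x : Fin n → ℝ) :
    IsProbabilityMeasure (empiricalLaw x) := by
  constructor
  simp only [empiricalLaw, Measure.smul_apply, Measure.finsetSum_apply, measure_univ,
    Finset.sum_const, Finset.card_univ, Fintype.card_fin, nsmul_eq_mul, mul_one, smul_eq_mul]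
  exact ENNReal.inv_mul_cancel (by exact_mod_cast hn) (ENNReal.natCast_ne_top n)

lemma empiricalLaw_real_singleton_le {x : Fin n → ℝ} (hx : Function.Injective x) (y : ℝ) :
    (empiricalLaw x).real {y} ≤ 1 / n := by
  have h : (∑ i, Measure.dirac (x i)) {y} ≤ 1 := by
    rw [Measure.finsetSum_apply]
    simp only [Measure.dirac_apply' _ (measurableSet_singleton y), Set.indicator_apply,
      Set.mem_singleton_iff, Pi.one_apply]
    by_cases hy : ∃ i, x i = y
    · obtain ⟨i, rfl⟩ := hy
      simp [hx.eq_iff]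
    · push Not at hy
      simp [hy]
  rw [measureReal_def, empiricalLaw, Measure.smul_apply, smul_eq_mul, ENNReal.toReal_mul,
    ENNReal.toReal_inv, ENNReal.toReal_natCast, one_div]
  refine mul_le_of_le_one_right (by positivity) ?_
  simpa using ENNReal.toReal_mono ENNReal.one_ne_top h

lemma isProbabilityMeasure_bootstrapLaw (hn : n ≠ 0) (x : Fin n → ℝ) :
    IsProbabilityMeasure (bootstrapLaw x) := by
  have := isProbabilityMeasure_empiricalLaw hn x
  unfold bootstrapLaw
  infer_instance

lemma rankHomogeneous_bootstrapLaw (hn : n ≠ 0) {x : Fin n → ℝ} (hx : Function.Injective x) :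
    RankHomogeneous (bootstrapLaw x) (fun i y => y i) (1 / n) := by
  have := isProbabilityMeasure_empiricalLaw hn x
  have := isProbabilityMeasure_bootstrapLaw hn x
  refine rankHomogeneous_of_map_eq (fun i => measurable_pi_apply i) ?_ (μ := empiricalLaw x) ?_
    (empiricalLaw_real_singleton_le hx)
  · exact iIndepFun_pi (X := fun _ y => y) fun _ => aemeasurable_id
  · exact fun i => (measurePreserving_eval (fun _ => empiricalLaw x) i).map_eq

end Bootstrap

end BootstrapKendall
end

/-! ### Comparison of the normalised variances -/

noncomputable section

namespace BootstrapKendall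

lemma eq_of_eventually_abs_sub_le {a b : ℝ} {u : ℕ → ℝ} (hu : Tendsto u atTop (𝓝 0))
    (h : ∀ᶠ n in atTop, |a - b| ≤ u n) : a = b :=
  sub_eq_zero.1 (abs_nonpos_iff.1 (ge_of_tendsto hu h))

lemma tendsto_const_mul_natCast_rpow_neg (c : ℝ) {s : ℝ} (hs : 0 < s) :
    Tendsto (fun n : ℕ => c * (n : ℝ) ^ (-s)) atTop (𝓝 0) := by
  simpa using ((tendsto_rpow_neg_atTop hs).comp tendsto_natCast_atTop_atTop).const_mul c

section Sample

variable {Ω : Type*} [MeasurableSpace Ω] {n : ℕ} {P : Measure Ω}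
  {Y : Fin n → Ω → ℝ} {ε : ℝ}

/-- The variance of the number of discordant pairs of the sample. -/
def discordanceVar (P : Measure Ω) (Y : Fin n → Ω → ℝ) : ℝ :=
  Var[fun ω => ∑ q ∈ descPairs n, if Y q.2 ω > Y q.1 ω then (1 : ℝ) else 0; P]

lemma variance_kendallU (P : Measure Ω) (Y : Fin n → Ω → ℝ) :
    Var[fun ω => kendallU (fun i => Y i ω); P]
      = (1 / ((n : ℝ) * ((n : ℝ) - 1))) ^ 2 * discordanceVar P Y := by
  simp_rw [kendallU_eq]
  exact variance_const_mul _ _ _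

lemma RankHomogeneous.discordanceVar_ge [IsProbabilityMeasure P]
    (h : RankHomogeneous P Y ε) (hε : 0 ≤ ε) (hn : 2 ≤ n)
    (hB : 28 * ε + 1 / n ≤ 1 / 96) : (n : ℝ) ^ 3 / 96 ≤ discordanceVar P Y := by
  have h1 := abs_le.1 (h.abs_variance_sub_le hε)
  have hn' : (2 : ℝ) ≤ n := by exact_mod_cast hn
  have hn0 : (0 : ℝ) < n := by linarith
  have h3 : (28 * ε + 1 / n) * (n : ℝ) ^ 3 ≤ 1 / 96 * (n : ℝ) ^ 3 := by gcongr
  have h4 : (28 * ε + 1 / n) * (n : ℝ) ^ 3 = 28 * ε * (n : ℝ) ^ 3 + (n : ℝ) ^ 2 := by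
    field_simp
  -- Equivalent to n^2 ≥ 4; an error of at most n^3/96 then leaves half of n^3/48.
  have h5 : (n : ℝ) ^ 3 / 48 ≤ n * ((n : ℝ) ^ 2 - 1) / 36 := by
    have : 0 ≤ n * ((n : ℝ) ^ 2 - 4) := mul_nonneg hn0.le (by nlinarith)
    nlinarith
  unfold discordanceVar
  linarith

lemma kendallSD_pos (hn : 2 ≤ n) (hV : 0 < discordanceVar P Y) : 0 < kendallSD P Y := by
  have hn' : (2 : ℝ) ≤ n := by exact_mod_cast hn
  have h1 : (0 : ℝ) < n * (n - 1) := mul_pos (by linarith) (by linarith)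
  rw [kendallSD, Real.sqrt_pos, variance_kendallU]
  positivity

/-- All normalisations cancel, leaving a relative error of unnormalised variances. -/
lemma bootstrapVar_sub_variance (hn : 2 ≤ n) (hV : 0 < discordanceVar P Y) (x : Fin n → ℝ) :
    bootstrapVar (fun x => (kendallSD P Y)⁻¹ * kendallU x) x
        - Var[fun ω => (kendallSD P Y)⁻¹ * kendallU (fun i => Y i ω); P]
      = (discordanceVar (bootstrapLaw x) (fun i y => y i) - discordanceVar P Y)
          / discordanceVar P Y := by
  have hn' : (2 : ℝ) ≤ n := by exact_mod_cast hn
  have h1 : (n : ℝ) ≠ 0 := by linarith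
  have h2 : (n : ℝ) - 1 ≠ 0 := by linarith
  have hsq : (kendallSD P Y)⁻¹ ^ 2
      = ((1 / ((n : ℝ) * ((n : ℝ) - 1))) ^ 2 * discordanceVar P Y)⁻¹ := by
    rw [inv_pow, kendallSD, Real.sq_sqrt (variance_nonneg _ _), variance_kendallU]
  have hb : Var[kendallU; bootstrapLaw x] = (1 / ((n : ℝ) * ((n : ℝ) - 1))) ^ 2
      * discordanceVar (bootstrapLaw x) (fun i y => y i) :=
    variance_kendallU (bootstrapLaw x) (fun i y => y i)
  rw [bootstrapVar, variance_const_mul, variance_const_mul, hb, variance_kendallU, hsq]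
  field_simp

/-- For data without ties the bootstrap variance is close to the variance of any sample whose
order relations have nearly the same probabilities as under a continuous distribution. -/
lemma RankHomogeneous.abs_bootstrapVar_sub_le [IsProbabilityMeasure P]
    (h : RankHomogeneous P Y ε) (hε : 0 ≤ ε) (hn : 2 ≤ n) (hB : 28 * ε + 1 / n ≤ 1 / 96) {x : Fin n → ℝ} (hx : Function.Injective x) :
    |bootstrapVar (fun x => (kendallSD P Y)⁻¹ * kendallU x) x
        - Var[fun ω => (kendallSD P Y)⁻¹ * kendallU (fun i => Y i ω); P]|
      ≤ 96 * (28 * ε + 30 / n) := by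
  have hn' : (2 : ℝ) ≤ n := by exact_mod_cast hn
  have hn0 : (0 : ℝ) < n := by linarith
  have hV := h.discordanceVar_ge hε hn hB
  have hV0 : 0 < discordanceVar P Y := lt_of_lt_of_le (by positivity) hV
  have := isProbabilityMeasure_bootstrapLaw (by omega : n ≠ 0) x
  have h1 := abs_le.1 (h.abs_variance_sub_le hε)
  have h2 := abs_le.1 ((rankHomogeneous_bootstrapLaw (by omega : n ≠ 0) hx).abs_variance_sub_le
    (by positivity))
  -- The bootstrap sample enters with ε = 1/n, whence 30 = 28 + 1 + 1.
  have h3 : 28 * ε * (n : ℝ) ^ 3 + (n : ℝ) ^ 2 + (28 * (1 / n) * (n : ℝ) ^ 3 + (n : ℝ) ^ 2)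
      = (28 * ε + 30 / n) * (n : ℝ) ^ 3 := by
    field_simp; ring
  have hnn : 0 ≤ 28 * ε + 30 / n := by positivity
  rw [bootstrapVar_sub_variance hn hV0, abs_div, abs_of_pos hV0, div_le_iff₀ hV0]
  have h4 : 96 * (28 * ε + 30 / n) * ((n : ℝ) ^ 3 / 96)
      ≤ 96 * (28 * ε + 30 / n) * discordanceVar P Y := by gcongr
  refine le_trans ?_ h4
  unfold discordanceVar
  rw [abs_le]
  constructor <;> linarith

lemma ae_injective [IsProbabilityMeasure P]
    (htie : ∀ i j, i ≠ j → P.real {ω | Y i ω = Y j ω} ≤ 0) :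
    ∀ᵐ ω ∂P, Function.Injective fun i => Y i ω := by
  have h : ∀ i j, i ≠ j → ∀ᵐ ω ∂P, Y i ω ≠ Y j ω := fun i j hij => by
    have h0 := le_antisymm (htie i j hij) measureReal_nonneg
    rw [measureReal_eq_zero_iff] at h0
    rw [ae_iff]
    simpa using h0
  have h' : ∀ᵐ ω ∂P, ∀ i j, i ≠ j → Y i ω ≠ Y j ω := by
    simp only [ae_all_iff]
    exact h
  filter_upwards [h'] with ω hω i j hij
  by_contra hne
  exact hω i j hne hij

end Sample

end BootstrapKendall
end

/-! ### The limit theorem -/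

theorem mainTheorem9
    {Ω : ℕ → Type*} [∀ n, MeasurableSpace (Ω n)]
    (P : ∀ n, Measure (Ω n)) [∀ n, IsProbabilityMeasure (P n)]
    -- a triangular array with independent, absolutely continuous rows
    (X : ∀ n, Fin n → Ω n → ℝ)
    (hmeas : ∀ n i, Measurable (X n i))
    (hindep : ∀ n, iIndepFun (X n) (P n))
    (hac : ∀ n i, (P n).map (X n i) ≪ volume)
    -- the degree of heterogeneity
    (δ p : ℕ → ℝ)
    (hδ : ∀ n, δ n ∈ Set.Ioo (0 : ℝ) 1)
    (hp : ∀ n, p n ∈ Set.Ioo (0 : ℝ) 1)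
    (hspread : ∀ᶠ n in atTop, ∀ i : Fin n,
      p n ≤ (P n).real {ω | ∀ j : Fin n, j ≠ i →
          BootstrapKendall.condProbGT (P n) (X n) j i ω
            - BootstrapKendall.probGT (P n) (X n) j i ∈ Set.Icc (δ n) 1} ∨
      p n ≤ (P n).real {ω | ∀ j : Fin n, j ≠ i →
          BootstrapKendall.condProbGT (P n) (X n) j i ω
            - BootstrapKendall.probGT (P n) (X n) j i ∈ Set.Icc (-1) (-δ n)})
    (hrate : BootstrapKendall.StrictlyDominates
      (fun n => δ n ^ 3 * p n) (fun n => (n : ℝ) ^ (-(1 / 3) : ℝ)))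
    -- homogeneity of the pairwise probabilities
    (θ C : ℝ) (hθ : 0 < θ) (hC : 0 < C)
    (hpair : ∀ n, ∀ i j : Fin n, i ≠ j →
      |BootstrapKendall.probGT (P n) (X n) i j - θ| ≤ C * (n : ℝ) ^ (-(1 / 6) : ℝ))
    (η C' : ℝ) (hη : 0 < η ^ 2) (hC' : 0 < C')
    (htriple : ∀ n, ∀ i j k : Fin n, j ≠ i → k ≠ i →
      |(∫ ω, BootstrapKendall.condProbGT (P n) (X n) j i ω
          * BootstrapKendall.condProbGT (P n) (X n) k i ω ∂(P n)) - η ^ 2|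
        ≤ C' * (n : ℝ) ^ (-(1 / 3) : ℝ))
    (hne : η ^ 2 ≠ θ ^ 2) :
    (∀ᶠ n in atTop, 0 < BootstrapKendall.kendallSD (P n) (X n)) ∧
    ∀ ε : ℝ, 0 < ε →
      Tendsto (fun n => P n {ω | ε ≤
        |BootstrapKendall.bootstrapVar
            (fun x => (BootstrapKendall.kendallSD (P n) (X n))⁻¹ * BootstrapKendall.kendallU x)
            (fun i => X n i ω)
          - variance (fun ω' => (BootstrapKendall.kendallSD (P n) (X n))⁻¹
              * BootstrapKendall.kendallU (fun i => X n i ω')) (P n)|})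
        atTop (𝓝 0) := by
  open BootstrapKendall in
  have htie : ∀ n, ∀ i j : Fin n, i ≠ j → (P n).real {ω | X n i ω = X n j ω} ≤ 0 := by
    intro n i j hij
    refine probReal_eq_le (hmeas n) (hindep n) hij fun x => ?_
    rw [measureReal_def, hac n j Real.volume_singleton]
    simp
  have hu : Tendsto (fun n : ℕ => C * (n : ℝ) ^ (-(1 / 6) : ℝ)) atTop (𝓝 0) :=
    tendsto_const_mul_natCast_rpow_neg C (by norm_num)
  have hv : Tendsto (fun n : ℕ => C' * (n : ℝ) ^ (-(1 / 3) : ℝ)) atTop (𝓝 0) :=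
    tendsto_const_mul_natCast_rpow_neg C' (by norm_num)
  have htri : ∀ n, ∀ i j k : Fin n, i ≠ j → i ≠ k → j ≠ k →
      |(P n).real (gtSet (X n) j i ∩ gtSet (X n) k i) - η ^ 2|
        ≤ C' * (n : ℝ) ^ (-(1 / 3) : ℝ) := by
    intro n i j k hij hik hjk
    rw [← integral_condProbGT_mul (hmeas n) (hindep n) hij hik hjk]
    exact htriple n i j k hij.symm hik.symm
  -- Both orders of one pair have probability near θ and sum to 1.
  have hθ' : θ = 1 / 2 := by
    refine eq_of_eventually_abs_sub_le hu ?_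
    filter_upwards [eventually_ge_atTop 2] with n hn
    have hij : (⟨0, by omega⟩ : Fin n) ≠ ⟨1, by omega⟩ := by simp
    have h1 := abs_le.1 (hpair n _ _ hij)
    have h2 := abs_le.1 (hpair n _ _ hij.symm)
    have h3 := probReal_gtSet_add_mem_Icc (hmeas n) (htie n _ _ hij)
    simp only [Set.mem_Icc, gtSet] at h3
    unfold probGT at h1 h2
    rw [abs_le]
    constructor <;> linarith
  -- Each of three variables is the minimum with probability near η^2, and these probabilities sum
  -- to 1.
  have hη' : η ^ 2 = 1 / 3 := by
    refine eq_of_eventually_abs_sub_le hv ?_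
    filter_upwards [eventually_ge_atTop 3] with n hn
    have hij : (⟨0, by omega⟩ : Fin n) ≠ ⟨1, by omega⟩ := by simp
    have hik : (⟨0, by omega⟩ : Fin n) ≠ ⟨2, by omega⟩ := by simp
    have hjk : (⟨1, by omega⟩ : Fin n) ≠ ⟨2, by omega⟩ := by simp
    have h1 := abs_le.1 (htri n _ _ _ hij hik hjk)
    have h2 := abs_le.1 (htri n _ _ _ hij.symm hjk hik)
    have h3 := abs_le.1 (htri n _ _ _ hik.symm hjk.symm hij)
    have h4 := probReal_triple_add_mem_Icc (hmeas n) (htie n _ _ hij) (htie n _ _ hik)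
      (htie n _ _ hjk)
    rw [Set.mem_Icc] at h4
    rw [abs_le]
    constructor <;> linarith
  set ε : ℕ → ℝ := fun n => C * (n : ℝ) ^ (-(1 / 6) : ℝ) + C' * (n : ℝ) ^ (-(1 / 3) : ℝ) with hεdef
  have hε0 : ∀ n, 0 ≤ ε n := fun n => by positivity
  have hεlim : Tendsto ε atTop (𝓝 0) := by
    rw [← add_zero (0 : ℝ)]; exact hu.add hv
  have hhom : ∀ n, RankHomogeneous (P n) (X n) (ε n) := fun n => by
    have hC0 : 0 ≤ C * (n : ℝ) ^ (-(1 / 6) : ℝ) := by positivity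
    have hC'0 : 0 ≤ C' * (n : ℝ) ^ (-(1 / 3) : ℝ) := by positivity
    refine ⟨hmeas n, hindep n, fun i j hij => (htie n i j hij).trans (hε0 n),
      fun i j hij => ?_, fun i j k hij hik hjk => ?_⟩
    · rw [← hθ']
      exact (hpair n j i hij.symm).trans (le_add_of_nonneg_right hC'0)
    · rw [← hη']
      exact (htri n i j k hij hik hjk).trans (le_add_of_nonneg_left hC0)
  have hBlim : Tendsto (fun n : ℕ => 28 * ε n + 1 / n) atTop (𝓝 0) := by
    simpa using (hεlim.const_mul 28).add tendsto_one_div_atTop_nhds_zero_nat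
  have hBev : ∀ᶠ n : ℕ in atTop, 28 * ε n + 1 / n ≤ 1 / 96 :=
    hBlim.eventually_le_const (by norm_num)
  refine ⟨?_, fun e he => ?_⟩
  · filter_upwards [hBev, eventually_ge_atTop 2] with n hB hn
    have hn0 : (0 : ℝ) < n := by exact_mod_cast (by omega : 0 < n)
    exact kendallSD_pos hn
      (lt_of_lt_of_le (by positivity) ((hhom n).discordanceVar_ge (hε0 n) hn hB))
  · have hDlim : Tendsto (fun n : ℕ => 96 * (28 * ε n + 30 / n)) atTop (𝓝 0) := by
      simpa using ((hεlim.const_mul 28).add (tendsto_const_div_atTop_nhds_zero_nat 30)).const_mul 96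
    -- The probabilities are eventually equal to 0: once the deterministic bound is below e, only
    -- samples with ties remain.
    refine tendsto_const_nhds.congr' ?_
    filter_upwards [hBev, eventually_ge_atTop 2, hDlim.eventually_lt_const he] with n hB hn hD
    symm
    have hsub : {ω | e ≤ |bootstrapVar (fun x => (kendallSD (P n) (X n))⁻¹ * kendallU x)
          (fun i => X n i ω) - variance (fun ω' => (kendallSD (P n) (X n))⁻¹
            * kendallU (fun i => X n i ω')) (P n)|}
        ⊆ {ω | ¬ Function.Injective fun i => X n i ω} := fun ω hω hinj =>
      absurd ((hhom n).abs_bootstrapVar_sub_le (hε0 n) hn hB hinj) (not_le.2 (hD.trans_le hω))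
    exact measure_mono_null hsub (ae_iff.1 (ae_injective (htie n)))
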